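/- Let $X,Y$ be real reflexive Banach spaces, let $Z_1,Z_2$ be real Banach spaces, and let $K\subset X$ and $\Lambda\subset Y$ be nonempty, bounded, closed and convex. For $\phi\colon X\to(-\infty,\infty]$ write $D(\phi)=\{x\in X:\phi(x)<\infty\}$, and for a locally Lipschitz $h\colon E\to\mathbb R$ on a Banach space $E$ let $$h^0(x;y)=\limsup_{z\to x,\ t\downarrow 0}\frac{h(z+ty)-h(z)}{t}$$ be the generalized directional derivative in the sense of Clarke. Assume that: (1) $\phi\colon X\to(-\infty,\infty]$ is proper, convex and lower semicontinuous, with $D(\phi)\cap K\neq\emptyset$; (2) $J\colon Z_1\to\mathbb R$ and $L\colon Z_2\to\mathbb R$ are locally Lipschitz; (3) $\gamma_1\colon X\to Z_1$ and $\gamma_2\colon Y\to Z_2$ are linear and compact operators; (4) $H\colon Y\to(0,m_H)$, for some $m_H>0$, is continuous with respect to the weak topology of $Y$; (5) $B\colon X\times Y\to\mathbb R$ is convex and lower semicontinuous on $X\times Y$; (6) $F\colon X\to X^*$ is such that, for each $v\in X$, $\liminf_{n\to\infty}\langle F(u_n),v-u_n\rangle\ge\langle F(u),v-u\rangle$ whenever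 $u_n\rightharpoonup u$ weakly in $X$; (7) $G\colon Y\to Y^*$ is such that, for each $\mu\in Y$, $\liminf_{n\to\infty}\langle G(\sigma_n),\mu-\sigma_n\rangle\ge\langle G(\sigma),\mu-\sigma\rangle$ whenever $\sigma_n\rightharpoonup\sigma$ weakly in $Y$. Then there exists $(u,\sigma)\in(K\cap D(\phi))\times\Lambda$ such that, for all $v\in K$ and all $\mu\in\Lambda$, $$\begin{cases} B(v,\sigma)-B(u,\sigma)+\phi(v)-\phi(u)+J^0(\gamma_1(u);\gamma_1(v-u))\ \ge\ \langle F(u),v-u\rangle,\\ B(u,\mu)-B(u,\sigma)+H(\sigma)\,L^0(\gamma_2(\sigma);\gamma_2(\mu-\sigma))\ \ge\ \langle G(\sigma),\mu-\sigma\rangle. \end{cases}$$ -/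

import Mathlib

open Filter Topology

namespace CoupledSystem

noncomputable section

/-- Reflexivity: the canonical embedding into the bidual is onto. -/
def IsReflexive (E : Type*) [NormedAddCommGroup E] [NormedSpace ℝ E] : Prop :=
  Function.Surjective (NormedSpace.inclusionInDoubleDual ℝ E)

/-- The effective domain `D(φ)` of an extended-real-valued functional. -/
def effectiveDomain {E : Type*} (φ : E → EReal) : Set E := {x | φ x < ⊤}

/-- `φ` takes values in `(-∞, ∞]` and is not identically `∞`. -/
def IsProper {E : Type*} (φ : E → EReal) : Prop :=
  (∀ x, φ x ≠ ⊥) ∧ (effectiveDomain φ).Nonempty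

/-- Convexity of a functional with values in `(-∞, ∞]`. In `EReal` one has `0 * ⊤ = 0`, so the
inequality is trivial for `t = 0` and `t = 1`. -/
def IsConvexFunctional {E : Type*} [AddCommGroup E] [Module ℝ E] (φ : E → EReal) : Prop :=
  ∀ x y : E, ∀ t : ℝ, 0 ≤ t → t ≤ 1 →
    φ (t • x + (1 - t) • y) ≤ (t : EReal) * φ x + ((1 - t : ℝ) : EReal) * φ y

/-- Clarke's generalized directional derivative
`h⁰(x; y) = limsup_{z → x, t ↓ 0} (h (z + t y) - h z) / t`.
For locally Lipschitz `h` the quotients are bounded near `(x, 0⁺)`, so the real `limsup` is the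
true one. -/
def clarkeDeriv {E : Type*} [NormedAddCommGroup E] [NormedSpace ℝ E] (h : E → ℝ) (x y : E) : ℝ :=
  limsup (fun p : E × ℝ => (h (p.1 + p.2 • y) - h p.1) / p.2) (𝓝 x ×ˢ 𝓝[>] (0 : ℝ))

/-- Weak convergence `xₙ ⇀ x` of a sequence. -/
def WeaklyConverges {E : Type*} [NormedAddCommGroup E] [NormedSpace ℝ E]
    (x : ℕ → E) (x₀ : E) : Prop :=
  Tendsto (fun n => toWeakSpace ℝ E (x n)) atTop (𝓝 (toWeakSpace ℝ E x₀))

/-- Weak continuity of a real functional: continuity for the weak topology of `E`. -/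
def IsWeaklyContinuous {E : Type*} [NormedAddCommGroup E] [NormedSpace ℝ E] (H : E → ℝ) : Prop :=
  Continuous (fun x : WeakSpace ℝ E => H ((toWeakSpace ℝ E).symm x))

/-- For every `v`, the map `u ↦ ⟨A u, v - u⟩` is weakly lower semicontinuous along sequences.
The `liminf` is taken in `[-∞, ∞]`. -/
def IsWeaklyLscPairing {E : Type*} [NormedAddCommGroup E] [NormedSpace ℝ E]
    (A : E → StrongDual ℝ E) : Prop :=
  ∀ (v : E) (u : ℕ → E) (u₀ : E), WeaklyConverges u u₀ →
    ((A u₀ (v - u₀) : ℝ) : EReal) ≤ liminf (fun n => ((A (u n) (v - u n) : ℝ) : EReal)) atTop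

/-- `(u, σ)` solves the coupled system: `u ∈ K ∩ D(φ)`, `σ ∈ Λ`, and both inequalities hold for all
`v ∈ K`, `μ ∈ Λ`. The first one is an inequality in `(-∞, ∞]`, as `φ v` may be `∞`. -/
structure IsSolution {X Y Z₁ Z₂ : Type*}
    [NormedAddCommGroup X] [NormedSpace ℝ X] [NormedAddCommGroup Y] [NormedSpace ℝ Y]
    [NormedAddCommGroup Z₁] [NormedSpace ℝ Z₁] [NormedAddCommGroup Z₂] [NormedSpace ℝ Z₂]
    (K : Set X) (Λ : Set Y) (B : X × Y → ℝ) (φ : X → EReal) (J : Z₁ → ℝ) (L : Z₂ → ℝ)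
    (H : Y → ℝ) (γ₁ : X →ₗ[ℝ] Z₁) (γ₂ : Y →ₗ[ℝ] Z₂)
    (F : X → StrongDual ℝ X) (G : Y → StrongDual ℝ Y) (u : X) (σ : Y) : Prop where
  mem_K : u ∈ K
  mem_domain : u ∈ effectiveDomain φ
  mem_Λ : σ ∈ Λ
  first : ∀ v ∈ K,
    ((B (v, σ) - B (u, σ) : ℝ) : EReal) + (φ v - φ u)
      + ((clarkeDeriv J (γ₁ u) (γ₁ (v - u)) : ℝ) : EReal) ≥ ((F u (v - u) : ℝ) : EReal)
  second : ∀ μ ∈ Λ,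
    B (u, μ) - B (u, σ) + H σ * clarkeDeriv L (γ₂ σ) (γ₂ (μ - σ)) ≥ G σ (μ - σ)

end

end CoupledSystem

/-!
Adding the two inequalities and replacing the two increments of `B` by `B (v, μ) - B (u, σ)` gives
a single inequality `φ u ≤ jointBound (u, σ) (v, μ)`. Conversely, testing with `(v, σ)` and `(u, μ)`
recovers the system. The joint bound is convex in the test point and equals `φ u` on the diagonal,
so the sets of candidates passing a given test cover convex hulls as in the
Knaster–Kuratowski–Mazurkiewicz (KKM) theorem; they are weakly sequentially closed in the weakly
compact set `K ×ˢ Λ`, hence weakly closed by Kaplansky's theorem and the metrizability of weakly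
compact sets in separable spaces. A common point solves the system.

The KKM theorem on a simplex is proved by Scarf's combinatorial argument: the lattice points of the
simplex carry one linear order per coordinate, and a parity count over dominant sets yields
arbitrarily small sets of lattice points carrying all colours.
-/

namespace CoupledSystem

/-! ### Scarf's theorem on dominant sets -/

section Scarf

open Classical in
theorem image_erase_eq_image_iff {α β : Type*} {s : Finset α} {f : α → β} {a : α} (ha : a ∈ s) :
    (s.erase a).image f = s.image f ↔ ∃ b ∈ s, b ≠ a ∧ f b = f a := by
  constructor
  · intro himage
    obtain ⟨b, hb, hba⟩ := Finset.mem_image.1 (himage ▸ Finset.mem_image_of_mem f ha)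
    exact ⟨b, Finset.mem_of_mem_erase hb, Finset.ne_of_mem_erase hb, hba⟩
  · rintro ⟨b, hb, hba, hfb⟩
    refine (Finset.image_subset_image (s.erase_subset a)).antisymm fun y hy => ?_
    obtain ⟨x, hx, rfl⟩ := Finset.mem_image.1 hy
    obtain rfl | hxa := eq_or_ne x a
    · exact Finset.mem_image.2 ⟨b, Finset.mem_erase.2 ⟨hba, hb⟩, hfb⟩
    · exact Finset.mem_image_of_mem f (Finset.mem_erase.2 ⟨hxa, hx⟩)

open Classical in
theorem card_filter_exists_ne_map_eq {α β : Type*} {s : Finset α} {f : α → β}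
    (h : (s.image f).card + 1 = s.card) :
    Finset.card {a ∈ s | ∃ b ∈ s, b ≠ a ∧ f b = f a} = 2 := by
  obtain ⟨a₁, h₁, a₂, h₂, hne, heq⟩ :=
    Finset.exists_ne_map_eq_of_card_lt_of_maps_to (t := s.image f) (by omega)
      fun a ha => Finset.mem_image_of_mem f ha
  have injOn_erase : ∀ a ∈ s, ∀ b ∈ s, b ≠ a → f b = f a → Set.InjOn f (s.erase a) := by
    intro a ha b hb hba hfb
    rw [← Finset.card_image_iff, (image_erase_eq_image_iff ha).2 ⟨b, hb, hba, hfb⟩,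
      Finset.card_erase_of_mem ha]
    omega
  refine Finset.card_eq_two.2 ⟨a₁, a₂, hne, ?_⟩
  ext a
  simp only [Finset.mem_filter, Finset.mem_insert, Finset.mem_singleton]
  constructor
  · rintro ⟨ha, b, hb, hba, hfb⟩
    by_contra! ha'
    have hb₁ : b = a₁ := by
      by_contra hb₁
      exact hba (injOn_erase a₁ h₁ a₂ h₂ hne.symm heq.symm (by simp [hb₁, hb]) (by simp [ha', ha])
        hfb)
    have hb₂ : b = a₂ := by
      by_contra hb₂
      exact hba (injOn_erase a₂ h₂ a₁ h₁ hne heq (by simp [hb₂, hb]) (by simp [ha', ha]) hfb)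
    exact hne (hb₁.symm.trans hb₂)
  · rintro (rfl | rfl)
    · exact ⟨h₁, a₂, h₂, hne.symm, heq.symm⟩
    · exact ⟨h₂, a₁, h₁, hne, heq⟩

variable {I U α : Type*} [LinearOrder α]

/-- Dominant sets for a family `k` of orders on `U`, one for each `i : I`: no point of `U` exceeds
the `i`-minimum of `S` for every `i`. They play the role of the simplices of a triangulation. -/
def Dominant (k : I → U → α) (S : Finset U) : Prop :=
  ∀ y, ∃ i, ∀ s ∈ S, k i y ≤ k i s

/-- The points exceeding the `j`-minimum of `S` for every `j ≠ i`. A dominant set is enlarged by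
adding the `i`-greatest such point, for a suitable `i`. -/
def exceedingExcept (k : I → U → α) (S : Finset U) (i : I) : Set U :=
  {y | ∀ j, j ≠ i → ∃ s ∈ S, k j s < k j y}

/-- The `i`-minimum of `S` is also its `j`-minimum for some `j ≠ i`. The indices sharing their
minimum are the directions in which a dominant set of codimension one can be enlarged. -/
def SharesMin (k : I → U → α) (S : Finset U) (i : I) : Prop :=
  ∃ j, j ≠ i ∧ ∃ m ∈ S, ∀ s ∈ S, k i m ≤ k i s ∧ k j m ≤ k j s

/-- The points `v i` act as the vertices of a simplex: `v i` is the `i`-least point, and the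
`v j` with `j ≠ i` lie `i`-above all points that are not vertices. -/
structure IsVertexFamily (k : I → U → α) (v : I → U) : Prop where
  le : ∀ i y, k i (v i) ≤ k i y
  lt : ∀ i j y, j ≠ i → y ∉ Set.range v → k i y < k i (v j)

variable {k : I → U → α} {S R : Finset U} {v : I → U} {c : U → I} {i₀ : I}

theorem Dominant.mono (hR : Dominant k R) (hSR : S ⊆ R) : Dominant k S := fun y =>
  (hR y).imp fun _ h s hs => h s (hSR hs)

theorem Dominant.eq_of_mem_exceedingExcept (hS : Dominant k S) {y : U} {i j : I}
    (hi : y ∈ exceedingExcept k S i) (hj : y ∈ exceedingExcept k S j) : i = j := by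
  obtain ⟨l, hl⟩ := hS y
  have eq_l : ∀ i, y ∈ exceedingExcept k S i → l = i := fun i hi => by
    by_contra hne
    obtain ⟨s, hs, hlt⟩ := hi l hne
    exact hlt.not_ge (hl s hs)
  exact (eq_l i hi).symm.trans (eq_l j hj)

open Classical in
theorem Dominant.notMem_and_insert (hk : ∀ i, Function.Injective (k i)) (hS : Dominant k S)
    {i : I} {z : U} (hi : SharesMin k S i) (hz : z ∈ exceedingExcept k S i)
    (hmax : ∀ y ∈ exceedingExcept k S i, k i y ≤ k i z) :
    z ∉ S ∧ Dominant k (insert z S) := by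
  constructor
  · intro hzS
    obtain ⟨j, hji, m, hm, hmin⟩ := hi
    obtain ⟨l, hl⟩ := hS z
    obtain rfl | hli := eq_or_ne l i
    · obtain rfl : z = m := hk l ((hl m hm).antisymm (hmin z hzS).1)
      obtain ⟨s, hs, hlt⟩ := hz j hji
      exact hlt.not_ge (hmin s hs).2
    · obtain ⟨s, hs, hlt⟩ := hz l hli
      exact hlt.not_ge (hl s hs)
  · intro y
    simp only [Finset.forall_mem_insert]
    obtain ⟨l, hl⟩ := hS y
    obtain rfl | hli := eq_or_ne l i
    · by_cases hy : y ∈ exceedingExcept k S l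
      · exact ⟨l, hmax y hy, hl⟩
      · simp only [exceedingExcept, Set.mem_ofPred_eq, not_forall, not_exists, not_and,
          not_lt] at hy
        obtain ⟨j, hj, hyj⟩ := hy
        obtain ⟨s, hs, hlt⟩ := hz j hj
        exact ⟨j, (hyj s hs).trans hlt.le, hyj⟩
    · obtain ⟨s, hs, hlt⟩ := hz l hli
      exact ⟨l, (hl s hs).trans hlt.le, hl⟩

variable [Fintype I]

open Classical in
theorem Dominant.exists_argmin (hk : ∀ i, Function.Injective (k i)) (hS : Dominant k S)
    (hne : S.Nonempty) :
    ∃ m : I → U, Finset.univ.image m = S ∧ ∀ i, ∀ s ∈ S, k i (m i) ≤ k i s := by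
  choose m hmS hmin using fun i => S.exists_min_image (k i) hne
  refine ⟨m, Finset.Subset.antisymm (by simpa [Finset.image_subset_iff] using hmS) fun s hs => ?_,
    hmin⟩
  obtain ⟨i, hi⟩ := hS s
  exact Finset.mem_image.2
    ⟨i, Finset.mem_univ i, hk i ((hmin i s hs).antisymm (hi _ (hmS i)))⟩

open Classical in
theorem Dominant.card_sharesMin (hk : ∀ i, Function.Injective (k i)) (hS : Dominant k S)
    (hne : S.Nonempty) (hcard : S.card + 1 = Fintype.card I) :
    Finset.card {i | SharesMin k S i} = 2 := by
  obtain ⟨m, himage, hmin⟩ := hS.exists_argmin hk hne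
  have hmem : ∀ i, m i ∈ S := fun i => himage ▸ Finset.mem_image_of_mem m (Finset.mem_univ i)
  rw [← card_filter_exists_ne_map_eq (s := Finset.univ) (f := m) (by rwa [himage])]
  congr 1
  ext i
  simp only [Finset.mem_filter, Finset.mem_univ, true_and]
  constructor
  · rintro ⟨j, hji, x, hx, hxmin⟩
    have hi : m i = x := hk i ((hmin i x hx).antisymm (hxmin _ (hmem i)).1)
    have hj : m j = x := hk j ((hmin j x hx).antisymm (hxmin _ (hmem j)).2)
    exact ⟨j, hji, hj.trans hi.symm⟩
  · rintro ⟨j, hji, heq⟩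
    exact ⟨j, hji, m i, hmem i, fun s hs => ⟨hmin i s hs, heq ▸ hmin j s hs⟩⟩

open Classical in
theorem Dominant.exists_of_insert (hk : ∀ i, Function.Injective (k i)) {z : U} (hzS : z ∉ S)
    (hR : Dominant k (insert z S)) (hne : S.Nonempty) (hcard : S.card + 1 = Fintype.card I) :
    ∃ i, SharesMin k S i ∧ z ∈ exceedingExcept k S i ∧
      ∀ y ∈ exceedingExcept k S i, k i y ≤ k i z := by
  obtain ⟨m, himage, hmin⟩ := hR.exists_argmin hk (S.insert_nonempty z)
  have hinj : Function.Injective m := by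
    rw [← Set.injOn_univ, ← Finset.coe_univ, ← Finset.card_image_iff, himage,
      Finset.card_insert_of_notMem hzS, hcard, Finset.card_univ]
  obtain ⟨i, -, hi⟩ := Finset.mem_image.1 (himage ▸ Finset.mem_insert_self z S)
  have hmS : ∀ j, j ≠ i → m j ∈ S := fun j hji =>
    (Finset.mem_insert.1 (himage ▸ Finset.mem_image_of_mem m (Finset.mem_univ j))).resolve_left
      fun h => hji (hinj (h.trans hi.symm))
  refine ⟨i, ?_, fun j hji => ⟨m j, hmS j hji, ?_⟩, fun y hy => ?_⟩
  · obtain ⟨x, hx, hxmin⟩ := S.exists_min_image (k i) hne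
    obtain ⟨j, -, rfl⟩ := Finset.mem_image.1 (himage ▸ Finset.mem_insert_of_mem hx)
    exact ⟨j, fun hji => hzS (hi ▸ hji ▸ hx), m j, hx, fun s hs =>
      ⟨hxmin s hs, hmin j s (Finset.mem_insert_of_mem hs)⟩⟩
  · exact (hmin j z (Finset.mem_insert_self z S)).lt_of_ne fun h =>
      hji (hinj ((hk j h).trans hi.symm))
  · obtain ⟨l, hl⟩ := hR y
    obtain rfl | hli := eq_or_ne l i
    · exact hl z (Finset.mem_insert_self z S)
    · obtain ⟨s, hs, hlt⟩ := hy l hli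
      exact absurd (hl s (Finset.mem_insert_of_mem hs)) hlt.not_ge

open Classical in
theorem IsVertexFamily.dominant_image_erase (hv : IsVertexFamily k v) (i₀ : I) :
    Dominant k ((Finset.univ.erase i₀).image v) := by
  intro y
  simp only [Finset.forall_mem_image, Finset.mem_erase, Finset.mem_univ, and_true]
  by_cases hy : y ∈ Set.range v
  · obtain ⟨i, rfl⟩ := hy
    exact ⟨i, fun j _ => hv.le i _⟩
  · exact ⟨i₀, fun j hj => (hv.lt i₀ j y hj hy).le⟩

open Classical in
theorem IsVertexFamily.exceedingExcept_image_erase_eq_empty (hv : IsVertexFamily k v) {i : I}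
    (hi : i ≠ i₀) (hmin : ∀ j, j ≠ i₀ → k i₀ (v i) ≤ k i₀ (v j)) :
    exceedingExcept k ((Finset.univ.erase i₀).image v) i = ∅ := by
  refine Set.eq_empty_of_forall_notMem fun y hy => ?_
  simp only [exceedingExcept, Finset.exists_mem_image, Finset.mem_erase, Finset.mem_univ,
    and_true, Set.mem_ofPred_eq] at hy
  obtain ⟨l, hl, hly⟩ := hy i₀ hi.symm
  have hiy : k i₀ (v i) < k i₀ y := (hmin l hl).trans_lt hly
  obtain ⟨j, rfl⟩ : y ∈ Set.range v := by
    by_contra hy'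
    exact (hv.lt i₀ i y hi hy').not_gt hiy
  obtain rfl | hji := eq_or_ne j i
  · exact hiy.false
  · obtain ⟨l, -, hlj⟩ := hy j hji
    exact (hv.le j (v l)).not_gt hlj

open Classical in
theorem IsVertexFamily.sharesMin_and_nonempty_iff [Nontrivial I]
    (hk : ∀ i, Function.Injective (k i)) (hv : IsVertexFamily k v) (hinj : Function.Injective v)
    {i : I} : SharesMin k ((Finset.univ.erase i₀).image v) i ∧
      (exceedingExcept k ((Finset.univ.erase i₀).image v) i).Nonempty ↔ i = i₀ := by
  have min_eq : ∀ i, i ≠ i₀ → ∀ l, k i (v l) ≤ k i (v i) → l = i := fun i _ l hle =>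
    hinj (hk i (hle.antisymm (hv.le i _)))
  constructor
  · rintro ⟨⟨j, hji, m, hm, hmin⟩, hne⟩
    simp only [Finset.forall_mem_image, Finset.mem_erase, Finset.mem_univ, and_true] at hmin
    obtain ⟨l, -, rfl⟩ := Finset.mem_image.1 hm
    by_contra hi
    obtain rfl := min_eq i hi l (hmin hi).1
    obtain rfl | hj := eq_or_ne j i₀
    · exact hne.ne_empty (hv.exceedingExcept_image_erase_eq_empty hi fun j' hj' => (hmin hj').2)
    · exact hji (min_eq j hj l (hmin hj).2).symm
  · rintro rfl
    refine ⟨?_, v i, fun j hj => ⟨v j, by simpa using ⟨j, hj, rfl⟩, ?_⟩⟩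
    · obtain ⟨j, hj⟩ := exists_ne i
      obtain ⟨l, hl, hmin⟩ :=
        (Finset.univ.erase i).exists_min_image (fun l => k i (v l)) ⟨j, by simpa using hj⟩
      refine ⟨l, Finset.ne_of_mem_erase hl, v l, Finset.mem_image_of_mem v hl, ?_⟩
      simpa only [Finset.forall_mem_image] using fun s hs => ⟨hmin s hs, hv.le l _⟩
    · exact (hv.le j _).lt_of_ne fun h => hj (hinj (hk j h))

open Classical in
theorem image_erase_eq_of_subset_range (hc : ∀ i, c (v i) = i)
    (hS : S.image c = Finset.univ.erase i₀) (hSv : ∀ x ∈ S, x ∈ Set.range v) :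
    S = (Finset.univ.erase i₀).image v := by
  ext x
  simp only [Finset.mem_image, Finset.mem_erase, Finset.mem_univ, and_true, ne_eq]
  have mem_iff : ∀ i, v i ∈ S ↔ i ≠ i₀ := fun i => by
    have : i ∈ S.image c ↔ i ≠ i₀ := by simp [hS]
    rw [← this, Finset.mem_image]
    constructor
    · exact fun h => ⟨v i, h, hc i⟩
    · rintro ⟨y, hy, rfl⟩
      obtain ⟨j, rfl⟩ := hSv y hy
      rwa [hc j]
  constructor
  · intro hx
    obtain ⟨i, rfl⟩ := hSv x hx
    exact ⟨i, (mem_iff i).1 hx, rfl⟩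
  · rintro ⟨i, hi, rfl⟩
    exact (mem_iff i).2 hi

section Fintype

variable [Fintype U]

open Classical in
theorem Dominant.card_covBy (hk : ∀ i, Function.Injective (k i)) (hS : Dominant k S)
    (hne : S.Nonempty) (hcard : S.card + 1 = Fintype.card I) :
    Finset.card {R | S ⋖ R ∧ Dominant k R} =
      Finset.card {i | SharesMin k S i ∧ (exceedingExcept k S i).Nonempty} := by
  have exists_greatest : ∀ i, (exceedingExcept k S i).Nonempty →
      ∃ z ∈ exceedingExcept k S i, ∀ y ∈ exceedingExcept k S i, k i y ≤ k i z := fun i h =>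
    Set.exists_max_image _ (k i) (Set.toFinite _) h
  have : Nonempty U := hne.to_type
  choose! g hg hmax using exists_greatest
  refine (Finset.card_bij (fun i _ => insert (g i) S) ?_ ?_ ?_).symm
  · simp only [Finset.mem_filter, Finset.mem_univ, true_and]
    rintro i ⟨hi, hex⟩
    obtain ⟨hnot, hdom⟩ := hS.notMem_and_insert hk hi (hg i hex) (hmax i hex)
    exact ⟨Finset.covBy_iff_exists_insert.2 ⟨g i, hnot, rfl⟩, hdom⟩
  · simp only [Finset.mem_filter, Finset.mem_univ, true_and]
    rintro i ⟨hi, hex⟩ j ⟨-, hex'⟩ heq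
    have hnot := (hS.notMem_and_insert hk hi (hg i hex) (hmax i hex)).1
    have hg_eq : g i = g j :=
      (Finset.mem_insert.1 (heq ▸ Finset.mem_insert_self (g i) S)).resolve_right hnot
    exact hS.eq_of_mem_exceedingExcept (hg i hex) (hg_eq ▸ hg j hex')
  · simp only [Finset.mem_filter, Finset.mem_univ, true_and]
    rintro R ⟨hcov, hR⟩
    obtain ⟨z, hzS, rfl⟩ := Finset.covBy_iff_exists_insert.1 hcov
    obtain ⟨i, hi, hz, hzmax⟩ := hR.exists_of_insert hk hzS hne hcard
    have hex : (exceedingExcept k S i).Nonempty := ⟨z, hz⟩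
    exact ⟨i, ⟨hi, hex⟩, by rw [hk i ((hzmax _ (hg i hex)).antisymm (hmax i hex z hz))]⟩

open Classical in
theorem even_card_covBy_image_eq_erase (hcard : R.card = Fintype.card I)
    (hR : R.image c ≠ Finset.univ) :
    Even (Finset.card {S | S ⋖ R ∧ S.image c = Finset.univ.erase i₀}) := by
  by_cases hdoor : R.image c = Finset.univ.erase i₀
  · have hshare : ({S | S ⋖ R ∧ S.image c = Finset.univ.erase i₀} : Finset (Finset U)) =
        ({a ∈ R | ∃ b ∈ R, b ≠ a ∧ c b = c a} : Finset U).image R.erase := by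
      ext S
      simp only [Finset.mem_filter, Finset.mem_univ, true_and, Finset.mem_image,
        Finset.covBy_iff_exists_erase, ← hdoor]
      constructor
      · rintro ⟨⟨a, ha, rfl⟩, himage⟩
        exact ⟨a, ⟨ha, (image_erase_eq_image_iff ha).1 himage⟩, rfl⟩
      · rintro ⟨a, ⟨ha, hex⟩, rfl⟩
        exact ⟨⟨a, ha, rfl⟩, (image_erase_eq_image_iff ha).2 hex⟩
    rw [hshare,
      Finset.card_image_of_injOn (R.erase_injOn.mono (by simp +contextual [Set.subset_def])),
      card_filter_exists_ne_map_eq]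
    · exact even_two
    · rw [hdoor, hcard, Finset.card_erase_add_one (Finset.mem_univ i₀), Finset.card_univ]
  · rw [Finset.filter_eq_empty_iff.2, Finset.card_empty]
    · exact Even.zero
    · rintro S - ⟨hcov, himage⟩
      have hsub : Finset.univ.erase i₀ ⊆ R.image c := himage ▸ Finset.image_subset_image hcov.le
      obtain h | h := (Finset.erase_covBy (Finset.mem_univ i₀)).eq_or_eq hsub (Finset.subset_univ _)
      exacts [hdoor h, hR h]

open Classical in
theorem IsVertexFamily.card_covBy [Nontrivial I] (hk : ∀ i, Function.Injective (k i))
    (hv : IsVertexFamily k v) (hinj : Function.Injective v) :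
    Finset.card {R | (Finset.univ.erase i₀).image v ⋖ R ∧ Dominant k R} = 1 := by
  obtain ⟨j, hj⟩ := exists_ne i₀
  rw [(hv.dominant_image_erase i₀).card_covBy hk ⟨v j, by simpa [hinj.eq_iff] using hj⟩
    (by rw [Finset.card_image_of_injective _ hinj, Finset.card_erase_add_one (Finset.mem_univ i₀),
      Finset.card_univ]), Finset.card_eq_one]
  exact ⟨i₀, by ext i; simp [hv.sharesMin_and_nonempty_iff hk hinj]⟩

open Classical in
theorem IsVertexFamily.card_covBy_of_notMem_range [Nontrivial I]
    (hk : ∀ i, Function.Injective (k i)) (hv : IsVertexFamily k v) (hS : Dominant k S)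
    (hcard : S.card + 1 = Fintype.card I) {x : U} (hx : x ∈ S) (hxv : x ∉ Set.range v) :
    Finset.card {R | S ⋖ R ∧ Dominant k R} = 2 := by
  have hne : ∀ i, (exceedingExcept k S i).Nonempty := fun i =>
    ⟨v i, fun j hj => ⟨x, hx, hv.lt j i x hj.symm hxv⟩⟩
  simpa only [hS.card_covBy hk ⟨x, hx⟩ hcard, hne, and_true] using
    hS.card_sharesMin hk ⟨x, hx⟩ hcard

open Classical in
/-- The dominant sets of full dimension, the rooms of the parity argument. -/
noncomputable def rooms (k : I → U → α) : Finset (Finset U) :=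
  {R | Dominant k R ∧ R.card = Fintype.card I}

open Classical in
/-- The dominant sets of codimension one carrying all colours but `i₀`: the doors between rooms
in the parity argument. -/
noncomputable def doors (k : I → U → α) (c : U → I) (i₀ : I) : Finset (Finset U) :=
  {S | Dominant k S ∧ S.card + 1 = Fintype.card I ∧ S.image c = Finset.univ.erase i₀}

open Classical in
theorem even_card_doors_bipartiteBelow (hR : R ∈ rooms k) (hc : R.image c ≠ Finset.univ) :
    Even ((doors k c i₀).bipartiteBelow (· ⋖ ·) R).card := by
  obtain ⟨hdom, hcard⟩ : Dominant k R ∧ R.card = Fintype.card I := by simpa [rooms] using hR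
  convert even_card_covBy_image_eq_erase (i₀ := i₀) hcard hc using 2
  ext S
  simp only [doors, Finset.mem_bipartiteBelow, Finset.mem_filter, Finset.mem_univ, true_and]
  exact ⟨fun h => ⟨h.2, h.1.2.2⟩, fun h =>
    ⟨⟨hdom.mono h.1.le, hcard ▸ Order.covBy_iff_add_one_eq.1 h.1.card_finset, h.2⟩, h.1⟩⟩

open Classical in
theorem IsVertexFamily.card_rooms_bipartiteAbove [Nontrivial I]
    (hk : ∀ i, Function.Injective (k i)) (hv : IsVertexFamily k v) (hc : ∀ i, c (v i) = i)
    (hS : S ∈ doors k c i₀) : ((rooms k).bipartiteAbove (· ⋖ ·) S).card =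
      if S = (Finset.univ.erase i₀).image v then 1 else 2 := by
  obtain ⟨hdom, hcard, himage⟩ :
    Dominant k S ∧ S.card + 1 = Fintype.card I ∧ S.image c = _ := by simpa [doors] using hS
  have habove : (rooms k).bipartiteAbove (· ⋖ ·) S =
      ({R | S ⋖ R ∧ Dominant k R} : Finset (Finset U)) := by
    ext R
    simp only [rooms, Finset.mem_bipartiteAbove, Finset.mem_filter, Finset.mem_univ, true_and]
    exact ⟨fun h => ⟨h.2, h.1.1⟩, fun h =>
      ⟨⟨h.2, hcard ▸ (Order.covBy_iff_add_one_eq.1 h.1.card_finset).symm⟩, h.1⟩⟩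
  rw [habove]
  split_ifs with h
  · exact h ▸ hv.card_covBy hk (Function.LeftInverse.injective hc)
  · obtain ⟨x, hx, hxv⟩ : ∃ x ∈ S, x ∉ Set.range v := by
      by_contra! hSv
      exact h (image_erase_eq_of_subset_range hc himage hSv)
    exact hv.card_covBy_of_notMem_range hk hdom hcard hx hxv

end Fintype

open Classical in
theorem IsVertexFamily.exists_dominant_image_eq_univ [Nontrivial I] [Finite U]
    (hk : ∀ i, Function.Injective (k i)) (hv : IsVertexFamily k v) (hc : ∀ i, c (v i) = i) :
    ∃ R, Dominant k R ∧ R.image c = Finset.univ := by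
  cases nonempty_fintype U
  by_contra! hnone
  obtain ⟨i₀⟩ : Nonempty I := inferInstance
  let S₀ : Finset U := (Finset.univ.erase i₀).image v
  have hS₀ : S₀ ∈ doors k c i₀ := by
    have hinj : Function.Injective v := Function.LeftInverse.injective hc
    simp [doors, S₀, hv.dominant_image_erase i₀, Finset.card_image_of_injective _ hinj,
      Finset.image_image, Function.comp_def, hc, Nat.sub_add_cancel Fintype.card_pos]
  have heven : Even (∑ S ∈ doors k c i₀, if S = S₀ then 1 else 2) := by
    rw [← Finset.sum_congr rfl fun S hS => hv.card_rooms_bipartiteAbove hk hc hS,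
      Finset.sum_card_bipartiteAbove_eq_sum_card_bipartiteBelow]
    exact Finset.even_sum _ fun R hR =>
      even_card_doors_bipartiteBelow hR (hnone R (Finset.mem_filter.1 hR).2.1)
  rw [← Finset.add_sum_erase _ _ hS₀, if_pos rfl,
    Finset.sum_congr rfl fun S hS => if_neg (Finset.ne_of_mem_erase hS), Finset.sum_const] at heven
  simp [parity_simps] at heven

end Scarf

/-! ### The Knaster–Kuratowski–Mazurkiewicz theorem on a simplex -/

section LatticeSimplex

/-- The points with natural number coordinates in the simplex `∑ i, x i = l`. They discretise the
standard simplex with mesh `1 / l`. -/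
abbrev LatticeSimplex (I : Type*) [Fintype I] (l : ℕ) : Type _ := {x : I → ℕ // ∑ i, x i = l}

variable {I : Type*} [Fintype I] {l : ℕ}

instance : Finite (LatticeSimplex I l) := by
  classical
  exact Set.Finite.subset (Set.finite_Iic fun _ => l) fun x (hx : ∑ i, x i = l) i =>
    hx ▸ Finset.single_le_sum_of_canonicallyOrdered (Finset.mem_univ i)

theorem exists_latticeSimplex_le {m : I → ℕ} (h : l ≤ ∑ i, m i) :
    ∃ x : LatticeSimplex I l, x.1 ≤ m := by
  classical
  induction l with
  | zero => exact ⟨⟨0, by simp⟩, fun i => Nat.zero_le _⟩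
  | succ l ih =>
    obtain ⟨x, hx⟩ := ih (by omega)
    obtain ⟨i, -, hi⟩ : ∃ i ∈ Finset.univ, x.1 i < m i :=
      Finset.exists_lt_of_sum_lt (by rw [x.2]; omega)
    refine ⟨⟨x.1 + Pi.single i 1, by simp [Finset.sum_add_distrib, x.2]⟩, fun j => ?_⟩
    obtain rfl | hj := eq_or_ne j i
    · simpa using hi
    · simpa [hj] using hx j

namespace LatticeSimplex

open Classical in
/-- The vertex `l • e_i` of the lattice simplex. -/
noncomputable def vertex (l : ℕ) (i : I) : LatticeSimplex I l := ⟨Pi.single i l, by simp⟩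

/-- The orders to which Scarf's theorem is applied: `x` comes `i`-before `y` when its `i`-th
coordinate is larger. Ties are broken so that vertices come last, and then by the enumeration
`e`. -/
noncomputable def key (e : LatticeSimplex I l → ℕ) (i : I) (x : LatticeSimplex I l) :
    ℕᵒᵈ ×ₗ ℕ ×ₗ ℕ :=
  toLex (OrderDual.toDual (x.1 i), toLex (if x ∈ Set.range (vertex l) then 1 else 0, e x))

variable {e : LatticeSimplex I l → ℕ}

theorem key_injective (he : Function.Injective e) (i : I) : Function.Injective (key e i) :=
  fun x y h => he (by simp_all [key])

theorem key_lt_key_of_lt {i : I} {x y : LatticeSimplex I l} (h : y.1 i < x.1 i) :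
    key e i x < key e i y :=
  Prod.Lex.toLex_lt_toLex.2 (Or.inl h)

theorem eq_vertex_of_le {i : I} {x : LatticeSimplex I l} (h : l ≤ x.1 i) : x = vertex l i := by
  classical
  have hsum : x.1 i + ∑ j ∈ Finset.univ.erase i, x.1 j = l := by
    rw [Finset.add_sum_erase _ _ (Finset.mem_univ i), x.2]
  ext j
  obtain rfl | hj := eq_or_ne j i
  · simp [vertex]; omega
  · have : x.1 j ≤ ∑ j ∈ Finset.univ.erase i, x.1 j :=
      Finset.single_le_sum_of_canonicallyOrdered (by simpa using hj)
    simp [vertex, hj]; omega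

theorem isVertexFamily_key : IsVertexFamily (key e) (vertex l) where
  le i y := by
    obtain h | h := lt_or_ge (y.1 i) l
    · exact (key_lt_key_of_lt (by simpa [vertex] using h)).le
    · rw [eq_vertex_of_le h]
  lt i j y hji hy := by
    have hj : (vertex l j).1 i = 0 := by simp [vertex, hji.symm]
    obtain h | h := (Nat.zero_le (y.1 i)).lt_or_eq
    · exact key_lt_key_of_lt (hj ▸ h)
    · refine Prod.Lex.toLex_lt_toLex.2 (Or.inr ⟨by simp [hj, ← h], Prod.Lex.toLex_lt_toLex.2 ?_⟩)
      simp only [hy, Set.mem_range_self, if_true, if_false]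
      exact Or.inl one_pos

theorem lt_add_card_of_dominant {R : Finset (LatticeSimplex I l)} (hR : Dominant (key e) R)
    (hpos : ∀ i, ∃ x ∈ R, 0 < x.1 i) {x y : LatticeSimplex I l} (hx : x ∈ R) (hy : y ∈ R) (i : I) :
    x.1 i < y.1 i + Fintype.card I := by
  classical
  have hne : R.Nonempty := ⟨x, hx⟩
  choose b hbR hb using fun i => R.exists_max_image (fun x => x.1 i) hne
  have hb_pos : ∀ i, 1 ≤ (b i).1 i := fun i =>
    let ⟨x, hx, hxi⟩ := hpos i
    Nat.one_le_of_lt (hxi.trans_le (hb i x hx))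
  -- A lattice point strictly below all the maxima would contradict dominance.
  have hsum : ∑ i, ((b i).1 i - 1) < l := by
    by_contra! hl
    obtain ⟨z, hz⟩ := exists_latticeSimplex_le hl
    obtain ⟨i, hi⟩ := hR z
    have hlt : z.1 i < (b i).1 i := by have := hz i; have := hb_pos i; grind
    exact (key_lt_key_of_lt hlt).not_ge (hi _ (hbR i))
  have hsub : ∑ i, (b i).1 i = ∑ i, ((b i).1 i - 1) + Fintype.card I := by
    rw [Fintype.card, Finset.card_eq_sum_ones, ← Finset.sum_add_distrib]
    exact Finset.sum_congr rfl fun i _ => (Nat.sub_add_cancel (hb_pos i)).symm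
  have herase : ∑ j ∈ Finset.univ.erase i, y.1 j ≤ ∑ j ∈ Finset.univ.erase i, (b j).1 j :=
    Finset.sum_le_sum fun j _ => hb j y hy
  have hy_sum := Finset.add_sum_erase _ y.1 (Finset.mem_univ i)
  have hb_sum := Finset.add_sum_erase _ (fun j => (b j).1 j) (Finset.mem_univ i)
  have := hb i x hx
  have := y.2
  grind

theorem exists_rainbow {c : LatticeSimplex I l → I} (hc : ∀ x : LatticeSimplex I l, 0 < x.1 (c x)) :
    ∃ s : I → LatticeSimplex I l, (∀ i, c (s i) = i) ∧
      ∀ i j a, (s i).1 a < (s j).1 a + Fintype.card I := by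
  classical
  obtain hI | hI := subsingleton_or_nontrivial I
  · exact ⟨vertex l, fun i => Subsingleton.elim _ _, fun i j a => by
      have := Fintype.card_pos_iff.2 ⟨i⟩
      rw [Subsingleton.elim i j]; omega⟩
  have := Fintype.ofFinite (LatticeSimplex I l)
  obtain ⟨e, he⟩ := exists_injective_nat (LatticeSimplex I l)
  have hc_vertex : ∀ i, c (vertex l i) = i := fun i => by
    by_contra h
    exact (hc (vertex l i)).ne' (Pi.single_eq_of_ne (M := fun _ => ℕ) h l)
  obtain ⟨R, hR, himage⟩ :=
    isVertexFamily_key.exists_dominant_image_eq_univ (key_injective he) hc_vertex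
  choose s hsR hs using fun i => Finset.mem_image.1 (himage ▸ Finset.mem_univ i)
  exact ⟨s, hs, fun i j => lt_add_card_of_dominant hR
    (fun i => ⟨s i, hsR i, by simpa only [hs] using hc (s i)⟩) (hsR i) (hsR j)⟩

/-- The point of the standard simplex with barycentric coordinates `x / l`. -/
noncomputable def toStdSimplex (x : LatticeSimplex I l) : I → ℝ := fun i => x.1 i / l

theorem toStdSimplex_mem (hl : l ≠ 0) (x : LatticeSimplex I l) :
    x.toStdSimplex ∈ stdSimplex ℝ I := by
  refine ⟨fun i => by unfold toStdSimplex; positivity, ?_⟩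
  simp only [toStdSimplex, ← Finset.sum_div, ← Nat.cast_sum, x.2]
  exact div_self (Nat.cast_ne_zero.2 hl)

theorem dist_toStdSimplex_le {x y : LatticeSimplex I l}
    (h : ∀ i, x.1 i < y.1 i + Fintype.card I) (h' : ∀ i, y.1 i < x.1 i + Fintype.card I) :
    dist x.toStdSimplex y.toStdSimplex ≤ Fintype.card I / l := by
  refine (dist_pi_le_iff (by positivity)).2 fun i => ?_
  simp only [toStdSimplex, Real.dist_eq]
  rw [← sub_div, abs_div, Nat.abs_cast]
  gcongr
  rw [abs_sub_le_iff]
  have : (x.1 i : ℝ) ≤ y.1 i + Fintype.card I := mod_cast (h i).le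
  have : (y.1 i : ℝ) ≤ x.1 i + Fintype.card I := mod_cast (h' i).le
  constructor <;> linarith

end LatticeSimplex

theorem exists_mem_forall_of_cover_stdSimplex [Nonempty I] {A : I → Set (I → ℝ)}
    (hA : ∀ i, IsClosed (A i)) (hcov : ∀ x ∈ stdSimplex ℝ I, ∃ i, 0 < x i ∧ x ∈ A i) :
    ∃ x ∈ stdSimplex ℝ I, ∀ i, x ∈ A i := by
  have exists_close : ∀ n : ℕ, ∃ s : I → I → ℝ, (∀ i, s i ∈ stdSimplex ℝ I ∧ s i ∈ A i) ∧
      ∀ i j, dist (s i) (s j) ≤ Fintype.card I / (n + 1 : ℕ) := by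
    intro n
    choose c hc_pos hcA using fun x : LatticeSimplex I (n + 1) =>
      hcov _ (x.toStdSimplex_mem n.succ_ne_zero)
    obtain ⟨s, hs, hclose⟩ := LatticeSimplex.exists_rainbow (c := c) fun x => by
      by_contra! h
      exact (hc_pos x).ne' (by simp [LatticeSimplex.toStdSimplex, Nat.le_zero.1 h])
    exact ⟨fun i => (s i).toStdSimplex,
      fun i => ⟨(s i).toStdSimplex_mem n.succ_ne_zero, by simpa only [hs] using hcA (s i)⟩,
      fun i j => LatticeSimplex.dist_toStdSimplex_le (hclose i j) (hclose j i)⟩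
  choose s hs hclose using exists_close
  obtain ⟨i₀⟩ := ‹Nonempty I›
  obtain ⟨x, hx, ψ, hψ, hlim⟩ :=
    (isCompact_stdSimplex ℝ I).tendsto_subseq fun n => (hs n i₀).1
  refine ⟨x, hx, fun i => (hA i).mem_of_tendsto (b := atTop) (f := fun n => s (ψ n) i) ?_
    (Eventually.of_forall fun n => (hs _ i).2)⟩
  have hmesh : Tendsto (fun n => (Fintype.card I / (n + 1 : ℕ) : ℝ)) atTop (𝓝 0) :=
    (tendsto_const_div_atTop_nhds_zero_nat _).comp (tendsto_add_atTop_nat 1)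
  exact tendsto_of_tendsto_of_dist hlim
    (squeeze_zero (fun _ => dist_nonneg) (fun n => hclose (ψ n) i₀ i) (hmesh.comp hψ.tendsto_atTop))

end LatticeSimplex

theorem exists_pos_weight_sum_mem {V ι : Type*} [AddCommGroup V] [Module ℝ V] [Fintype ι]
    {v : ι → V} {A : ι → Set V}
    (hcov : ∀ s : Finset ι, convexHull ℝ (v '' s) ⊆ ⋃ i ∈ s, A i) {x : ι → ℝ}
    (hx : x ∈ stdSimplex ℝ ι) : ∃ i, 0 < x i ∧ ∑ j, x j • v j ∈ A i := by
  let s : Finset ι := {j | 0 < x j}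
  have hpos : ∀ j, x j ≠ 0 → 0 < x j := fun j hj => (hx.1 j).lt_of_ne' hj
  have hsum : ∑ j ∈ s, x j = 1 := by
    rw [← hx.2]
    exact Finset.sum_filter_of_ne fun j _ hj => hpos j hj
  have hcomb : ∑ j ∈ s, x j • v j = ∑ j, x j • v j :=
    Finset.sum_filter_of_ne fun j _ hj => hpos j (left_ne_zero_of_smul hj)
  have hmem : ∑ j, x j • v j ∈ convexHull ℝ (v '' s) := hcomb ▸
    (convex_convexHull ℝ _).sum_mem (fun j _ => hx.1 j) hsum fun j hj =>
      subset_convexHull ℝ _ (Set.mem_image_of_mem v (Finset.mem_coe.2 hj))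
  obtain ⟨i, hi, hiA⟩ := Set.mem_iUnion₂.1 (hcov s hmem)
  exact ⟨i, (Finset.mem_filter.1 hi).2, hiA⟩

/-- **Fan's KKM principle**. -/
theorem exists_mem_forall_of_convexHull_subset {V ι : Type*} [AddCommGroup V] [Module ℝ V]
    [TopologicalSpace V] [ContinuousAdd V] [ContinuousSMul ℝ V] {v : ι → V} {S : ι → Set V}
    (hS : ∀ i, IsClosed (S i)) {i₀ : ι} (hcompact : IsCompact (S i₀))
    (hcov : ∀ t : Finset ι, convexHull ℝ (v '' t) ⊆ ⋃ i ∈ t, S i) : ∃ z, ∀ i, z ∈ S i := by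
  classical
  have finite_inter : ∀ t : Finset ι, t.Nonempty → ∃ z, ∀ i ∈ t, z ∈ S i := by
    intro t hne
    have := hne.to_subtype
    obtain ⟨x, -, hx⟩ := exists_mem_forall_of_cover_stdSimplex
      (A := fun i : t => {x : t → ℝ | ∑ j, x j • v j ∈ S i})
      (fun i => (hS i).preimage (by fun_prop)) fun x hx =>
        exists_pos_weight_sum_mem (v := fun i : t => v i) (A := fun i : t => S i) (fun s => by
          simpa [Set.image_image, Set.iUnion_subtype] using hcov (s.image Subtype.val)) hx
    exact ⟨_, fun i hi => hx ⟨i, hi⟩⟩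
  obtain ⟨z, -, hz⟩ := hcompact.inter_iInter_nonempty S hS fun a => by
    obtain ⟨z, hz⟩ := finite_inter (insert i₀ a) (Finset.insert_nonempty _ _)
    exact ⟨z, hz i₀ (Finset.mem_insert_self _ _), Set.mem_iInter₂.2 fun i hi =>
      hz i (Finset.mem_insert_of_mem hi)⟩
  exact ⟨z, Set.mem_iInter.1 hz⟩

/-! ### Weak topology -/

section Weak

variable {E F : Type*} [NormedAddCommGroup E] [NormedSpace ℝ E] [NormedAddCommGroup F]
  [NormedSpace ℝ F]

theorem continuous_dual_weakSpace (f : StrongDual ℝ E) :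
    Continuous fun y : WeakSpace ℝ E => f ((toWeakSpace ℝ E).symm y) :=
  WeakBilin.eval_continuous (topDualPairing ℝ E).flip f

theorem isClosed_toWeakSpace_image {s : Set E} (hs : IsClosed s) (hc : Convex ℝ s) :
    IsClosed (toWeakSpace ℝ E '' s) := by
  rw [← closure_eq_iff_isClosed, ← hc.toWeakSpace_closure ℝ, hs.closure_eq]

theorem IsReflexive.isCompact_toWeakSpace_image (hE : IsReflexive E) {s : Set E}
    (hb : Bornology.IsBounded s) (hs : IsClosed s) (hc : Convex ℝ s) :
    IsCompact (toWeakSpace ℝ E '' s) := by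
  rw [← (isClosed_toWeakSpace_image hs hc).closure_eq]
  refine NormedSpace.isCompact_closure_of_isBounded ℝ E _ ?_ ?_
  · rwa [Set.preimage_image_eq _ (toWeakSpace ℝ E).injective]
  · rintro f -
    obtain ⟨x, hx⟩ := hE (WeakDual.toStrongDual f)
    exact ⟨toWeakSpace ℝ E x, WeakDual.toStrongDual.injective hx⟩

theorem isCompact_toWeakSpace_image_prod {s : Set E} {t : Set F}
    (hs : IsCompact (toWeakSpace ℝ E '' s)) (ht : IsCompact (toWeakSpace ℝ F '' t)) :
    IsCompact (toWeakSpace ℝ (E × F) '' s ×ˢ t) := by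
  let pair : WeakSpace ℝ E × WeakSpace ℝ F → WeakSpace ℝ (E × F) := fun p =>
    toWeakSpace ℝ (E × F) ((toWeakSpace ℝ E).symm p.1, (toWeakSpace ℝ F).symm p.2)
  have hpair : Continuous pair := WeakBilin.continuous_of_continuous_eval _ fun f => by
    refine (((continuous_dual_weakSpace (f.comp (.inl ℝ E F))).comp continuous_fst).add
      ((continuous_dual_weakSpace (f.comp (.inr ℝ E F))).comp continuous_snd)).congr fun p => ?_
    change f (_, 0) + f (0, _) = f (_, _)
    rw [← map_add, Prod.mk_add_mk, add_zero, zero_add]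
    rfl
  have himage : pair '' ((toWeakSpace ℝ E '' s) ×ˢ (toWeakSpace ℝ F '' t)) =
      toWeakSpace ℝ (E × F) '' s ×ˢ t := by
    rw [Set.prod_image_image_eq, Set.image_image]
    simp [pair]
  exact himage ▸ (hs.prod ht).image hpair

theorem mem_closure_toWeakSpace_image_iff {A : Set E} {x : E} :
    toWeakSpace ℝ E x ∈ closure (toWeakSpace ℝ E '' A) ↔
      ∀ (n : ℕ) (f : Fin n → StrongDual ℝ E), ∃ a ∈ A, ∀ i, |f i (a - x)| < 1 := by
  constructor
  · intro h n f
    have hopen : IsOpen {y : WeakSpace ℝ E | ∀ i, |f i ((toWeakSpace ℝ E).symm y - x)| < 1} := by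
      simp only [Set.ofPred_forall]
      refine isOpen_iInter_of_finite fun i => ?_
      simp only [map_sub]
      exact isOpen_lt ((continuous_dual_weakSpace (f i)).sub continuous_const).abs continuous_const
    obtain ⟨_, hy, a, ha, rfl⟩ := mem_closure_iff.1 h _ hopen (by simp)
    exact ⟨a, ha, by simpa using hy⟩
  · intro h
    rw [mem_closure_iff_nhds]
    intro t ht
    have hind : IsInducing fun (y : WeakSpace ℝ E) (f : StrongDual ℝ E) =>
        f ((toWeakSpace ℝ E).symm y) := ⟨rfl⟩
    rw [hind.nhds_eq_comap, mem_comap, nhds_pi] at ht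
    obtain ⟨V, hV, hVt⟩ := ht
    obtain ⟨s, u, hu, hsu⟩ := mem_pi'.1 hV
    choose ε hε hball using fun f => Metric.mem_nhds_iff.1 (hu f)
    obtain ⟨a, ha, hlt⟩ := h s.card fun i => (ε (s.equivFin.symm i))⁻¹ • (s.equivFin.symm i).1
    refine ⟨_, hVt (hsu fun f hf => hball f ?_), a, ha, rfl⟩
    have hfa := hlt (s.equivFin ⟨f, hf⟩)
    simp only [Equiv.symm_apply_apply, _root_.smul_apply, smul_eq_mul, abs_mul,
      abs_inv, abs_of_pos (hε f)] at hfa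
    rw [inv_mul_lt_iff₀ (hε f), mul_one, map_sub] at hfa
    simpa [Real.dist_eq] using hfa

theorem exists_finite_subset_forall_dual_norm_le {ι : Type*} [Finite ι] {A : Set E} {x : E}
    (hA : ∀ f : ι → StrongDual ℝ E, ∃ a ∈ A, ∀ i, |f i (a - x)| < 1) (r : ℝ) :
    ∃ C ⊆ A, C.Finite ∧ ∀ f : ι → StrongDual ℝ E, (∀ i, ‖f i‖ ≤ r) →
      ∃ a ∈ C, ∀ i, |f i (a - x)| < 1 := by
  let ball : Set (ι → WeakDual ℝ E) :=
    Set.univ.pi fun _ => WeakDual.toStrongDual ⁻¹' Metric.closedBall 0 r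
  have hball : IsCompact ball := isCompact_univ_pi fun _ => WeakDual.isCompact_closedBall _ _
  obtain ⟨C, hCA, hCf, hC⟩ := hball.elim_finite_subcover_image (b := A)
    (c := fun a => {f : ι → WeakDual ℝ E | ∀ i, |f i (a - x)| < 1})
    (fun a _ => by
      simp only [Set.ofPred_forall]
      exact isOpen_iInter_of_finite fun i =>
        isOpen_lt ((WeakDual.eval_continuous _).comp (continuous_apply i)).abs continuous_const)
    (fun f _ => by
      obtain ⟨a, ha, h⟩ := hA fun i => WeakDual.toStrongDual (f i)
      exact Set.mem_biUnion ha h)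
  refine ⟨C, hCA, hCf, fun f hf => ?_⟩
  have hmem : (fun i => StrongDual.toWeakDual (f i)) ∈ ball :=
    fun i _ => mem_closedBall_zero_iff.2 (hf i)
  simpa using hC hmem

/-- **Kaplansky's theorem** on countable tightness. Compactness of the `n`-fold products of dual
balls leaves only finitely many points to choose for each `n` and each radius. -/
theorem exists_countable_mem_closure_toWeakSpace_image {A : Set E} {x : E}
    (hx : toWeakSpace ℝ E x ∈ closure (toWeakSpace ℝ E '' A)) :
    ∃ C ⊆ A, C.Countable ∧ toWeakSpace ℝ E x ∈ closure (toWeakSpace ℝ E '' C) := by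
  rw [mem_closure_toWeakSpace_image_iff] at hx
  choose C hCA hCf hC using fun p : ℕ × ℕ =>
    exists_finite_subset_forall_dual_norm_le (hx p.1) (p.2 : ℝ)
  refine ⟨⋃ p, C p, Set.iUnion_subset hCA, Set.countable_iUnion fun p => (hCf p).countable, ?_⟩
  rw [mem_closure_toWeakSpace_image_iff]
  intro n f
  obtain ⟨m, hm⟩ := exists_nat_ge (∑ i, ‖f i‖)
  obtain ⟨a, ha, h⟩ := hC (n, m) f fun i =>
    (Finset.single_le_sum (fun j _ => norm_nonneg (f j)) (Finset.mem_univ i)).trans hm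
  exact ⟨a, Set.mem_iUnion.2 ⟨_, ha⟩, h⟩

theorem exists_dual_seq_separating {M : Set E} (hM : TopologicalSpace.IsSeparable M) :
    ∃ g : ℕ → StrongDual ℝ E, ∀ y ∈ M, (∀ n, g n y = 0) → y = 0 := by
  obtain ⟨c, hc, hMc⟩ := hM
  rcases c.eq_empty_or_nonempty with rfl | hne
  · exact ⟨0, fun y hy => by simpa using hMc hy⟩
  obtain ⟨d, rfl⟩ := hc.exists_eq_range hne
  choose g hg1 hg using fun n => exists_dual_vector'' ℝ (d n)
  refine ⟨g, fun y hy h0 => norm_le_zero_iff.1 (le_of_forall_pos_le_add fun ε hε => ?_)⟩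
  obtain ⟨_, ⟨n, rfl⟩, hn⟩ := Metric.mem_closure_iff.1 (hMc hy) (ε / 2) (half_pos hε)
  rw [dist_eq_norm] at hn
  have hdn : ‖d n‖ ≤ ‖y - d n‖ := by
    calc ‖d n‖ = -(g n (y - d n)) := by rw [map_sub, h0, hg]; simp
      _ ≤ ‖g n (y - d n)‖ := neg_le_abs _
      _ ≤ ‖y - d n‖ := by simpa using (g n).le_of_opNorm_le (hg1 n) (y - d n)
  have htriangle : ‖y‖ ≤ ‖y - d n‖ + ‖d n‖ := by simpa using norm_add_le (y - d n) (d n)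
  linarith

theorem metrizableSpace_of_isCompact_of_subset_isSeparable {M : Submodule ℝ E}
    (hM : TopologicalSpace.IsSeparable (M : Set E)) {W : Set (WeakSpace ℝ E)} (hW : IsCompact W)
    (hWM : W ⊆ toWeakSpace ℝ E '' M) : TopologicalSpace.MetrizableSpace W := by
  have : CompactSpace W := isCompact_iff_compactSpace.1 hW
  obtain ⟨g, hg⟩ := exists_dual_seq_separating hM
  refine Metric.PiNatEmbed.TopologicalSpace.MetrizableSpace.of_countable_separating
    (fun n (w : W) => g n ((toWeakSpace ℝ E).symm w.1))
    (fun n => (continuous_dual_weakSpace (g n)).comp continuous_subtype_val) ?_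
  rintro ⟨w, hw⟩ ⟨w', hw'⟩ hne
  obtain ⟨y, hy, rfl⟩ := hWM hw
  obtain ⟨z, hz, rfl⟩ := hWM hw'
  by_contra! heq
  have hyz : y - z = 0 := hg _ (M.sub_mem hy hz) fun n => by
    simpa [sub_eq_zero] using heq n
  exact hne (by simp [sub_eq_zero.1 hyz])

theorem exists_seq_weaklyConverges_of_mem_closure {Q A : Set E}
    (hQ : IsCompact (toWeakSpace ℝ E '' Q)) (hAQ : A ⊆ Q) {x : E}
    (hx : toWeakSpace ℝ E x ∈ closure (toWeakSpace ℝ E '' A)) :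
    ∃ u : ℕ → E, (∀ n, u n ∈ A) ∧ WeaklyConverges u x := by
  obtain ⟨C, hCA, hC, hxC⟩ := exists_countable_mem_closure_toWeakSpace_image hx
  let M : Submodule ℝ E := (Submodule.span ℝ C).topologicalClosure
  have hM_closed : IsClosed (M : Set E) := Submodule.isClosed_topologicalClosure _
  have hM_sep : TopologicalSpace.IsSeparable (M : Set E) := by
    rw [Submodule.topologicalClosure_coe]
    exact hC.isSeparable.span.closure
  let W : Set (WeakSpace ℝ E) := toWeakSpace ℝ E '' Q ∩ toWeakSpace ℝ E '' M
  have hW : IsCompact W := hQ.inter_right (isClosed_toWeakSpace_image hM_closed M.convex)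
  have hCW : toWeakSpace ℝ E '' C ⊆ W := Set.subset_inter (Set.image_mono (hCA.trans hAQ))
    (Set.image_mono (Submodule.subset_span.trans (Submodule.le_topologicalClosure _)))
  have hxW : toWeakSpace ℝ E x ∈ W := closure_minimal hCW hW.isClosed hxC
  have := metrizableSpace_of_isCompact_of_subset_isSeparable hM_sep hW Set.inter_subset_right
  have hcl : (⟨_, hxW⟩ : W) ∈ closure (Subtype.val ⁻¹' (toWeakSpace ℝ E '' C) : Set W) := by
    rwa [closure_subtype, Set.image_preimage_eq_of_subset (by rwa [Subtype.range_coe])]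
  obtain ⟨w, hw, hlim⟩ := mem_closure_iff_seq_limit.1 hcl
  choose u hu huw using hw
  exact ⟨u, fun n => hCA (hu n),
    ((continuous_subtype_val.tendsto _).comp hlim).congr fun n => (huw n).symm⟩

theorem isClosed_toWeakSpace_image_of_seq {Q A : Set E} (hQ : IsCompact (toWeakSpace ℝ E '' Q))
    (hAQ : A ⊆ Q) (hA : ∀ (u : ℕ → E) (x : E), (∀ n, u n ∈ A) → WeaklyConverges u x → x ∈ A) :
    IsClosed (toWeakSpace ℝ E '' A) := by
  refine isClosed_of_closure_subset fun z hz => ?_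
  obtain ⟨x, rfl⟩ := (toWeakSpace ℝ E).surjective z
  obtain ⟨u, hu, hux⟩ := exists_seq_weaklyConverges_of_mem_closure hQ hAQ hz
  exact ⟨x, hA u x hu hux, rfl⟩

theorem exists_mem_forall_of_weaklyConverges_mem {ι : Type*} [Nonempty ι] {Q : Set E} {v : ι → E}
    {S : ι → Set E} (hQ : IsCompact (toWeakSpace ℝ E '' Q)) (hSQ : ∀ i, S i ⊆ Q)
    (hS : ∀ i (u : ℕ → E) (x : E), (∀ n, u n ∈ S i) → WeaklyConverges u x → x ∈ S i)
    (hcov : ∀ t : Finset ι, convexHull ℝ (v '' t) ⊆ ⋃ i ∈ t, S i) : ∃ z, ∀ i, z ∈ S i := by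
  have hclosed : ∀ i, IsClosed (toWeakSpace ℝ E '' S i) := fun i =>
    isClosed_toWeakSpace_image_of_seq hQ (hSQ i) (hS i)
  obtain ⟨i₀⟩ := ‹Nonempty ι›
  obtain ⟨z, hz⟩ := exists_mem_forall_of_convexHull_subset (v := toWeakSpace ℝ E ∘ v) hclosed
    (hQ.of_isClosed_subset (hclosed i₀) (Set.image_mono (hSQ i₀))) fun t => by
      rw [Set.image_comp, ← LinearEquiv.coe_coe, ← LinearMap.image_convexHull, ← Set.image_iUnion₂]
      exact Set.image_mono (hcov t)
  exact ⟨(toWeakSpace ℝ E).symm z, fun i =>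
    (Set.mem_image_equiv (f := (toWeakSpace ℝ E).toEquiv)).1 (hz i)⟩

namespace WeaklyConverges

variable {u : ℕ → E} {x : E}

theorem map (h : WeaklyConverges u x) (f : E →L[ℝ] F) :
    WeaklyConverges (fun n => f (u n)) (f x) :=
  ((WeakSpace.map f).continuous.tendsto _).comp h

theorem tendsto_dual (h : WeaklyConverges u x) (f : StrongDual ℝ E) :
    Tendsto (fun n => f (u n)) atTop (𝓝 (f x)) :=
  ((continuous_dual_weakSpace f).tendsto _).comp h

theorem eventually_notMem (h : WeaklyConverges u x) {s : Set E} (hs : IsClosed s)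
    (hc : Convex ℝ s) (hx : x ∉ s) : ∀ᶠ n in atTop, u n ∉ s := by
  filter_upwards [h.eventually ((isClosed_toWeakSpace_image hs hc).isOpen_compl.mem_nhds
    (by simpa using hx))] with n hn hmem
  exact hn ⟨_, hmem, rfl⟩

theorem mem_of_isCompact (h : WeaklyConverges u x) {Q : Set E}
    (hQ : IsCompact (toWeakSpace ℝ E '' Q)) (hu : ∀ n, u n ∈ Q) : x ∈ Q := by
  simpa using hQ.isClosed.mem_of_tendsto h (Eventually.of_forall fun n => ⟨_, hu n, rfl⟩)

theorem isBounded_range (h : WeaklyConverges u x) : Bornology.IsBounded (Set.range u) := by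
  obtain ⟨C, hC⟩ := banach_steinhaus (g := fun n => NormedSpace.inclusionInDoubleDual ℝ E (u n))
    fun f => by
      obtain ⟨C, hC⟩ := (h.tendsto_dual f).norm.bddAbove_range
      exact ⟨C, fun n => hC ⟨n, rfl⟩⟩
  refine isBounded_iff_forall_norm_le.2 ⟨C, ?_⟩
  rintro _ ⟨n, rfl⟩
  rw [← (NormedSpace.inclusionInDoubleDualLi ℝ).norm_map (u n)]
  exact hC n

theorem tendsto_of_isCompactOperator (h : WeaklyConverges u x) {γ : E →ₗ[ℝ] F}
    (hγ : IsCompactOperator γ) : Tendsto (fun n => γ (u n)) atTop (𝓝 (γ x)) := by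
  obtain ⟨Q, hQ, hsub⟩ := hγ.image_subset_compact_of_bounded h.isBounded_range
  refine hQ.tendsto_nhds_of_unique_mapClusterPt
    (Eventually.of_forall fun n => hsub ⟨_, ⟨n, rfl⟩, rfl⟩) fun y _ hy => ?_
  have hlim : WeaklyConverges (fun n => γ (u n)) (γ x) := h.map ⟨γ, hγ.continuous⟩
  have hcluster : MapClusterPt (toWeakSpace ℝ F y) atTop fun n => toWeakSpace ℝ F (γ (u n)) :=
    hy.continuousAt_comp (f := toWeakSpace ℝ F) (toWeakSpaceCLM ℝ F).continuous.continuousAt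
  exact (toWeakSpace ℝ F).injective
    (eq_of_nhds_neBot (hcluster.neBot.mono (inf_le_inf_left _ hlim)))

end WeaklyConverges

end Weak

/-! ### Clarke's generalized directional derivative -/

section Clarke

/-- The filter of base points `z → x` and step sizes `t ↓ 0` along which `clarkeDeriv h x` is a
`limsup`. -/
abbrev clarkeFilter {E : Type*} [TopologicalSpace E] (x : E) : Filter (E × ℝ) :=
  𝓝 x ×ˢ 𝓝[>] (0 : ℝ)

theorem eventually_clarkeFilter_pos {E : Type*} [TopologicalSpace E] (x : E) :
    ∀ᶠ p in clarkeFilter x, 0 < p.2 :=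
  tendsto_snd.eventually self_mem_nhdsWithin

variable {E : Type*} [NormedAddCommGroup E] [NormedSpace ℝ E] {h : E → ℝ}

theorem tendsto_clarkeFilter_nhds (x y : E) :
    Tendsto (fun p : E × ℝ => p.1 + p.2 • y) (clarkeFilter x) (𝓝 x) := by
  have hlim : Tendsto (fun p : E × ℝ => p.1 + p.2 • y) (𝓝 (x, 0)) (𝓝 (x + (0 : ℝ) • y)) :=
    (by fun_prop : Continuous fun p : E × ℝ => p.1 + p.2 • y).tendsto _
  rw [zero_smul, add_zero, nhds_prod_eq] at hlim
  exact hlim.mono_left (prod_mono_right _ nhdsWithin_le_nhds)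

theorem tendsto_clarkeFilter_scale {a : ℝ} (ha : 0 < a) (x y : E) :
    Tendsto (fun p : E × ℝ => (p.1 + p.2 • y, a * p.2)) (clarkeFilter x) (clarkeFilter x) := by
  refine (tendsto_clarkeFilter_nhds x y).prodMk (tendsto_nhdsWithin_iff.2 ⟨?_, ?_⟩)
  · have hlim : Tendsto (fun p : E × ℝ => p.2) (clarkeFilter x) (𝓝 0) :=
      tendsto_snd.mono_right nhdsWithin_le_nhds
    simpa using hlim.const_mul a
  · filter_upwards [eventually_clarkeFilter_pos x] with p hp
    exact mul_pos ha hp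

theorem exists_eventually_abs_sub_le (hh : LocallyLipschitz h) (x : E) :
    ∃ C : ℝ, ∀ᶠ x' in 𝓝 x, ∀ y y' : E, ∀ᶠ p in clarkeFilter x',
      |h (p.1 + p.2 • y) - h (p.1 + p.2 • y')| ≤ C * (p.2 * ‖y - y'‖) := by
  obtain ⟨C, U, hU, hC⟩ := hh x
  refine ⟨C, ?_⟩
  filter_upwards [eventually_eventually_nhds.2 hU] with x' hx' y y'
  filter_upwards [(tendsto_clarkeFilter_nhds x' y).eventually hx',
    (tendsto_clarkeFilter_nhds x' y').eventually hx', eventually_clarkeFilter_pos x']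
    with p hy hy' hp
  have hdist := hC.dist_le_mul _ hy _ hy'
  rwa [Real.dist_eq, dist_eq_norm, add_sub_add_left_eq_sub, ← smul_sub, norm_smul,
    Real.norm_of_nonneg hp.le] at hdist

theorem exists_eventually_abs_quotient_le (hh : LocallyLipschitz h) (x y : E) :
    ∃ C, ∀ᶠ p in clarkeFilter x, |(h (p.1 + p.2 • y) - h p.1) / p.2| ≤ C := by
  obtain ⟨C, hC⟩ := exists_eventually_abs_sub_le hh x
  refine ⟨C * ‖y‖, ?_⟩
  filter_upwards [hC.self_of_nhds y 0, eventually_clarkeFilter_pos x] with p hdiff hp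
  rw [abs_div, abs_of_pos hp, div_le_iff₀ hp]
  simpa [mul_assoc, mul_comm, mul_left_comm] using hdiff

theorem eventually_quotient_lt (hh : LocallyLipschitz h) {x y : E} {c : ℝ}
    (hc : clarkeDeriv h x y < c) :
    ∀ᶠ p in clarkeFilter x, (h (p.1 + p.2 • y) - h p.1) / p.2 < c := by
  obtain ⟨C, hC⟩ := exists_eventually_abs_quotient_le hh x y
  exact eventually_lt_of_limsup_lt hc
    (isBoundedUnder_of_eventually_le (hC.mono fun p hp => (abs_le.1 hp).2))

theorem clarkeDeriv_le (hh : LocallyLipschitz h) {x y : E} {c : ℝ}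
    (hc : ∀ᶠ p in clarkeFilter x, (h (p.1 + p.2 • y) - h p.1) / p.2 ≤ c) :
    clarkeDeriv h x y ≤ c := by
  obtain ⟨C, hC⟩ := exists_eventually_abs_quotient_le hh x y
  exact limsup_le_of_le (isBoundedUnder_of_eventually_ge
    (hC.mono fun p hp => (abs_le.1 hp).1)).isCoboundedUnder_le hc

theorem clarkeDeriv_zero (h : E → ℝ) (x : E) : clarkeDeriv h x 0 = 0 := by
  simp [clarkeDeriv]

theorem eventually_clarkeDeriv_lt (hh : LocallyLipschitz h) {x y : E} {c : ℝ}
    (hc : clarkeDeriv h x y < c) : ∀ᶠ p in 𝓝 x ×ˢ 𝓝 y, clarkeDeriv h p.1 p.2 < c := by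
  obtain ⟨c₁, hc₁, hc₁c⟩ := exists_between hc
  obtain ⟨c₂, hc₁₂, hc₂c⟩ := exists_between hc₁c
  obtain ⟨C, hC⟩ := exists_eventually_abs_sub_le hh x
  have hquot : ∀ᶠ x' in 𝓝 x, ∀ᶠ p in clarkeFilter x', (h (p.1 + p.2 • y) - h p.1) / p.2 < c₁ := by
    obtain ⟨P, hP, Q, hQ, hPQ⟩ := eventually_prod_iff.1 (eventually_quotient_lt hh hc₁)
    filter_upwards [eventually_eventually_nhds.2 hP] with x' hx'
    exact eventually_prod_iff.2 ⟨P, hx', Q, hQ, hPQ⟩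
  have hdir : ∀ᶠ y' in 𝓝 y, C * ‖y' - y‖ < c₂ - c₁ :=
    (by fun_prop : Continuous fun y' => C * ‖y' - y‖).tendsto y |>.eventually_lt_const
      (by simpa using hc₁₂)
  filter_upwards [prod_mem_prod (inter_mem hC hquot) hdir] with ⟨x', y'⟩ ⟨⟨hlip, hx'⟩, hy'⟩
  refine (clarkeDeriv_le hh (c := c₂) ?_).trans_lt hc₂c
  filter_upwards [hx', hlip y' y, eventually_clarkeFilter_pos x'] with p hp hdiff hpos
  rw [div_lt_iff₀ hpos] at hp
  rw [div_le_iff₀ hpos]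
  have hdir_p : C * ‖y' - y‖ * p.2 < (c₂ - c₁) * p.2 := mul_lt_mul_of_pos_right hy' hpos
  linarith [(abs_le.1 hdiff).2]

theorem clarkeDeriv_add_le (hh : LocallyLipschitz h) (x y y' : E) :
    clarkeDeriv h x (y + y') ≤ clarkeDeriv h x y + clarkeDeriv h x y' := by
  refine le_of_forall_pos_le_add fun ε hε => clarkeDeriv_le hh ?_
  have hy := eventually_quotient_lt hh (lt_add_of_pos_right (clarkeDeriv h x y) (half_pos hε))
  have hy' := eventually_quotient_lt hh (lt_add_of_pos_right (clarkeDeriv h x y') (half_pos hε))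
  filter_upwards [(tendsto_clarkeFilter_scale one_pos x y').eventually hy, hy'] with p hpy hpy'
  simp only [one_mul] at hpy
  have hstep : p.1 + p.2 • (y + y') = p.1 + p.2 • y' + p.2 • y := by module
  have hsplit : (h (p.1 + p.2 • (y + y')) - h p.1) / p.2 =
      (h (p.1 + p.2 • y' + p.2 • y) - h (p.1 + p.2 • y')) / p.2 +
        (h (p.1 + p.2 • y') - h p.1) / p.2 := by
    rw [hstep, ← add_div, sub_add_sub_cancel]
  linarith

theorem clarkeDeriv_smul_le (hh : LocallyLipschitz h) (x y : E) {a : ℝ} (ha : 0 ≤ a) :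
    clarkeDeriv h x (a • y) ≤ a * clarkeDeriv h x y := by
  rcases ha.eq_or_lt with rfl | ha
  · simp [clarkeDeriv_zero]
  refine le_of_forall_gt_imp_ge_of_dense fun c hc => clarkeDeriv_le hh ?_
  have hquot := eventually_quotient_lt hh ((lt_div_iff₀' ha).2 hc)
  filter_upwards [(tendsto_clarkeFilter_scale ha x 0).eventually hquot,
    eventually_clarkeFilter_pos x] with p hp hpos
  simp only [smul_zero, add_zero] at hp
  have hscale : (h (p.1 + p.2 • a • y) - h p.1) / p.2 =
      a * ((h (p.1 + (a * p.2) • y) - h p.1) / (a * p.2)) := by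
    rw [smul_smul, mul_comm p.2 a]
    field_simp
  exact hscale ▸ ((lt_div_iff₀' ha).1 hp).le

theorem convexOn_clarkeDeriv (hh : LocallyLipschitz h) (x : E) :
    ConvexOn ℝ Set.univ (clarkeDeriv h x) :=
  ⟨convex_univ, fun y _ y' _ _ _ ha hb _ => (clarkeDeriv_add_le hh x _ _).trans
    (add_le_add (clarkeDeriv_smul_le hh x y ha) (clarkeDeriv_smul_le hh x y' hb))⟩

end Clarke

/-! ### Semicontinuity along weakly convergent sequences -/

section Functionals

variable {E : Type*} [NormedAddCommGroup E] [NormedSpace ℝ E]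

theorem coe_toReal_of_mem_effectiveDomain {α : Type*} {φ : α → EReal} {x : α} (hφ : φ x ≠ ⊥)
    (hx : x ∈ effectiveDomain φ) : ((φ x).toReal : EReal) = φ x :=
  EReal.coe_toReal (ne_of_lt hx) hφ

namespace IsConvexFunctional

variable {V : Type*} [AddCommGroup V] [Module ℝ V] {φ : V → EReal}

theorem quasiconvexOn (hc : IsConvexFunctional φ) : QuasiconvexOn ℝ Set.univ φ := by
  rintro r x ⟨-, hx⟩ y ⟨-, hy⟩ a b ha hb hab
  obtain rfl : b = 1 - a := by linarith
  refine ⟨trivial, (hc x y a ha (by linarith)).trans ?_⟩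
  calc (a : EReal) * φ x + ((1 - a : ℝ) : EReal) * φ y
      ≤ a * r + ((1 - a : ℝ) : EReal) * r := by
        gcongr
    _ = r := by
        rw [← EReal.right_distrib_of_nonneg (mod_cast ha) (mod_cast hb), ← EReal.coe_add,
          add_sub_cancel, EReal.coe_one, one_mul]

theorem convexOn_toReal (hφ : ∀ x, φ x ≠ ⊥) (hc : IsConvexFunctional φ) :
    ConvexOn ℝ (effectiveDomain φ) fun x => (φ x).toReal := by
  have hconv : Convex ℝ (effectiveDomain φ) := by
    simpa [effectiveDomain] using hc.quasiconvexOn.convex_lt ⊤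
  refine ⟨hconv, fun x hx y hy a b ha hb hab => ?_⟩
  obtain rfl : b = 1 - a := by linarith
  have hle := hc x y a ha (by linarith)
  rw [← coe_toReal_of_mem_effectiveDomain (hφ _) hx, ← coe_toReal_of_mem_effectiveDomain (hφ _) hy,
    ← coe_toReal_of_mem_effectiveDomain (hφ _) (hconv hx hy ha hb hab)] at hle
  exact_mod_cast hle

end IsConvexFunctional

theorem IsWeaklyLscPairing.eventually_lt {A : E → StrongDual ℝ E} (hA : IsWeaklyLscPairing A)
    {u : ℕ → E} {x : E} (h : WeaklyConverges u x) (v : E) {c : ℝ} (hc : c < A x (v - x)) :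
    ∀ᶠ n in atTop, c < A (u n) (v - u n) :=
  (eventually_lt_of_lt_liminf ((EReal.coe_lt_coe_iff.2 hc).trans_le (hA v u x h))).mono
    fun _ hn => EReal.coe_lt_coe_iff.1 hn

namespace WeaklyConverges

variable {u : ℕ → E} {x : E}

theorem eventually_lt_of_quasiconvexOn {β : Type*} [LinearOrder β] {f : E → β} {c : β}
    (h : WeaklyConverges u x) (hf : QuasiconvexOn ℝ Set.univ f) (hlsc : LowerSemicontinuous f)
    (hc : c < f x) : ∀ᶠ n in atTop, c < f (u n) := by
  have hconv : Convex ℝ {x | f x ≤ c} := by simpa using hf c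
  exact (h.eventually_notMem (hlsc.isClosed_preimage c) hconv hc.not_ge).mono
    fun _ hn => lt_of_not_ge hn

theorem eventually_clarkeDeriv_lt {Z : Type*} [NormedAddCommGroup Z] [NormedSpace ℝ Z] {h : Z → ℝ}
    (hu : WeaklyConverges u x) (hh : LocallyLipschitz h) {γ : E →ₗ[ℝ] Z} (hγ : IsCompactOperator γ)
    (v : E) {c : ℝ} (hc : clarkeDeriv h (γ x) (γ (v - x)) < c) :
    ∀ᶠ n in atTop, clarkeDeriv h (γ (u n)) (γ (v - u n)) < c := by
  have hlim := hu.tendsto_of_isCompactOperator hγ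
  simp only [map_sub] at hc ⊢
  exact (hlim.prodMk (hlim.const_sub (γ v))).eventually
    (CoupledSystem.eventually_clarkeDeriv_lt hh hc)

end WeaklyConverges

theorem eventually_mul_lt_of_tendsto {ι : Type*} {l : Filter ι} {a b : ι → ℝ} {a₀ b₀ c : ℝ}
    (ha_nonneg : ∀ i, 0 ≤ a i) (ha : Tendsto a l (𝓝 a₀))
    (hb : ∀ d, b₀ < d → ∀ᶠ i in l, b i < d) (hc : a₀ * b₀ < c) : ∀ᶠ i in l, a i * b i < c := by
  have hright : Tendsto (a₀ * ·) (𝓝[>] b₀) (𝓝 (a₀ * b₀)) :=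
    ((continuous_const_mul a₀).tendsto b₀).mono_left nhdsWithin_le_nhds
  obtain ⟨d, hd, hbd⟩ := ((hright.eventually_lt_const hc).and self_mem_nhdsWithin).exists
  filter_upwards [hb d hbd, (ha.mul_const d).eventually_lt_const hd] with i hbi hai
  exact (mul_le_mul_of_nonneg_left hbi.le (ha_nonneg i)).trans_lt hai

end Functionals

/-! ### The coupled system -/

section System

variable {X Y Z₁ Z₂ : Type*}
    [NormedAddCommGroup X] [NormedSpace ℝ X] [NormedAddCommGroup Y] [NormedSpace ℝ Y]
    [NormedAddCommGroup Z₁] [NormedSpace ℝ Z₁] [NormedAddCommGroup Z₂] [NormedSpace ℝ Z₂]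

/-- The right-hand side of the sum of the two inequalities of the system at the candidate `z`
with test point `w`, solved for `φ z.1`. The two increments of `B` are merged into `B w - B z`,
which makes the bound jointly convex in `w`; `toReal` is harmless since `w.1` is only taken in the
effective domain. -/
noncomputable def jointBound (B : X × Y → ℝ) (φ : X → EReal) (J : Z₁ → ℝ) (L : Z₂ → ℝ)
    (H : Y → ℝ) (γ₁ : X →ₗ[ℝ] Z₁) (γ₂ : Y →ₗ[ℝ] Z₂)
    (F : X → StrongDual ℝ X) (G : Y → StrongDual ℝ Y) (z w : X × Y) : ℝ :=
  B w - B z + (φ w.1).toReal + clarkeDeriv J (γ₁ z.1) (γ₁ (w.1 - z.1))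
    + H z.2 * clarkeDeriv L (γ₂ z.2) (γ₂ (w.2 - z.2)) - F z.1 (w.1 - z.1) - G z.2 (w.2 - z.2)

variable {B : X × Y → ℝ} {φ : X → EReal} {J : Z₁ → ℝ} {L : Z₂ → ℝ} {H : Y → ℝ}
  {γ₁ : X →ₗ[ℝ] Z₁} {γ₂ : Y →ₗ[ℝ] Z₂} {F : X → StrongDual ℝ X} {G : Y → StrongDual ℝ Y}

theorem jointBound_self (z : X × Y) : jointBound B φ J L H γ₁ γ₂ F G z z = (φ z.1).toReal := by
  simp [jointBound, clarkeDeriv_zero]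

theorem convexOn_jointBound (hφ : ∀ x, φ x ≠ ⊥) (hφc : IsConvexFunctional φ)
    (hJ : LocallyLipschitz J) (hL : LocallyLipschitz L) (hB : ConvexOn ℝ Set.univ B) (z : X × Y)
    (hH : 0 ≤ H z.2) :
    ConvexOn ℝ (Prod.fst ⁻¹' effectiveDomain φ) (jointBound B φ J L H γ₁ γ₂ F G z) := by
  have hφ_fst : ConvexOn ℝ (Prod.fst ⁻¹' effectiveDomain φ) fun w : X × Y => (φ w.1).toReal :=
    (hφc.convexOn_toReal hφ).comp_linearMap (LinearMap.fst ℝ X Y)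
  have hJ₀ : ConvexOn ℝ Set.univ fun d : X × Y => clarkeDeriv J (γ₁ z.1) (γ₁ d.1) :=
    (convexOn_clarkeDeriv hJ _).comp_linearMap (γ₁ ∘ₗ LinearMap.fst ℝ X Y)
  have hL₀ : ConvexOn ℝ Set.univ fun d : X × Y => H z.2 * clarkeDeriv L (γ₂ z.2) (γ₂ d.2) :=
    ((convexOn_clarkeDeriv hL _).comp_linearMap (γ₂ ∘ₗ LinearMap.snd ℝ X Y)).smul hH
  have hFG : ConvexOn ℝ Set.univ fun d : X × Y => -((F z.1).coprod (G z.2)) d :=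
    (-((F z.1).coprod (G z.2))).toLinearMap.convexOn convex_univ
  have hincrement := ((hJ₀.add hL₀).add hFG).translate_left (-z)
  have hconv := hφ_fst.add (((hB.add_const (-B z)).add hincrement).subset (Set.subset_univ _)
    hφ_fst.1)
  refine hconv.congr fun w _ => ?_
  simp [jointBound, sub_eq_add_neg]
  ring

theorem le_jointBound_of_weaklyConverges (hφc : IsConvexFunctional φ)
    (hφl : LowerSemicontinuous φ) (hJ : LocallyLipschitz J) (hL : LocallyLipschitz L)
    (hγ₁ : IsCompactOperator γ₁) (hγ₂ : IsCompactOperator γ₂) (hH : ∀ σ, 0 ≤ H σ)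
    (hHc : IsWeaklyContinuous H) (hB : ConvexOn ℝ Set.univ B) (hBl : LowerSemicontinuous B)
    (hF : IsWeaklyLscPairing F) (hG : IsWeaklyLscPairing G) (w : X × Y) {u : ℕ → X × Y}
    {z : X × Y} (hu : WeaklyConverges u z)
    (hle : ∀ n, φ (u n).1 ≤ (jointBound B φ J L H γ₁ γ₂ F G (u n) w : ℝ)) :
    φ z.1 ≤ (jointBound B φ J L H γ₁ γ₂ F G z w : ℝ) := by
  by_contra! hlt
  obtain ⟨c, hbound, hcφ⟩ := EReal.lt_iff_exists_real_btwn.1 hlt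
  rw [EReal.coe_lt_coe_iff] at hbound
  obtain ⟨ε, hε, hεc⟩ : ∃ ε, 0 < ε ∧ jointBound B φ J L H γ₁ γ₂ F G z w + 5 * ε = c :=
    ⟨(c - jointBound B φ J L H γ₁ γ₂ F G z w) / 5, by linarith, by ring⟩
  have hu₁ : WeaklyConverges (fun n => (u n).1) z.1 := hu.map (ContinuousLinearMap.fst ℝ X Y)
  have hu₂ : WeaklyConverges (fun n => (u n).2) z.2 := hu.map (ContinuousLinearMap.snd ℝ X Y)
  have hHu : Tendsto (fun n => H (u n).2) atTop (𝓝 (H z.2)) :=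
    (hHc.tendsto (toWeakSpace ℝ Y z.2)).comp hu₂
  obtain ⟨n, hφn, hBn, hJn, hLn, hFn, hGn⟩ :=
    ((hu₁.eventually_lt_of_quasiconvexOn hφc.quasiconvexOn hφl hcφ).and
    ((hu.eventually_lt_of_quasiconvexOn hB.quasiconvexOn hBl (sub_lt_self (B z) hε)).and
    ((hu₁.eventually_clarkeDeriv_lt hJ hγ₁ w.1 (lt_add_of_pos_right _ hε)).and
    ((eventually_mul_lt_of_tendsto (fun n => hH _) hHu
      (fun d hd => hu₂.eventually_clarkeDeriv_lt hL hγ₂ w.2 hd) (lt_add_of_pos_right _ hε)).and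
    ((hF.eventually_lt hu₁ w.1 (sub_lt_self _ hε)).and
    (hG.eventually_lt hu₂ w.2 (sub_lt_self _ hε))))))).exists
  have hcn := EReal.coe_lt_coe_iff.1 (hφn.trans_le (hle n))
  simp only [jointBound] at hcn hεc
  linarith

theorem exists_le_jointBound_of_mem_convexHull (hφ : ∀ x, φ x ≠ ⊥) (hφc : IsConvexFunctional φ)
    (hJ : LocallyLipschitz J) (hL : LocallyLipschitz L) (hB : ConvexOn ℝ Set.univ B)
    {t : Set (X × Y)} (ht : t ⊆ Prod.fst ⁻¹' effectiveDomain φ) {z : X × Y}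
    (hz : z ∈ convexHull ℝ t) (hH : 0 ≤ H z.2) :
    ∃ w ∈ t, φ z.1 ≤ (jointBound B φ J L H γ₁ γ₂ F G z w : ℝ) := by
  have hconv := convexOn_jointBound (γ₁ := γ₁) (γ₂ := γ₂) (F := F) (G := G) hφ hφc hJ hL hB z hH
  obtain ⟨w, hw, hle⟩ := hconv.exists_ge_of_mem_convexHull ht hz
  rw [jointBound_self] at hle
  refine ⟨w, hw, ?_⟩
  rw [← coe_toReal_of_mem_effectiveDomain (hφ _) (convexHull_min ht hconv.1 hz)]
  exact_mod_cast hle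

theorem isSolution_of_le_jointBound {K : Set X} {Λ : Set Y} (hφ : ∀ x, φ x ≠ ⊥) {z : X × Y}
    (hzK : z.1 ∈ K) (hzD : z.1 ∈ effectiveDomain φ) (hzΛ : z.2 ∈ Λ)
    (h : ∀ w ∈ (K ∩ effectiveDomain φ) ×ˢ Λ,
      φ z.1 ≤ (jointBound B φ J L H γ₁ γ₂ F G z w : ℝ)) :
    IsSolution K Λ B φ J L H γ₁ γ₂ F G z.1 z.2 := by
  have hφz := coe_toReal_of_mem_effectiveDomain (hφ _) hzD
  have hreal : ∀ w ∈ (K ∩ effectiveDomain φ) ×ˢ Λ,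
      (φ z.1).toReal ≤ jointBound B φ J L H γ₁ γ₂ F G z w := fun w hw => by
    have hle := h w hw
    rw [← hφz] at hle
    exact_mod_cast hle
  refine ⟨hzK, hzD, hzΛ, fun v hv => ?_, fun μ hμ => ?_⟩
  · rw [← hφz]
    by_cases hvD : v ∈ effectiveDomain φ
    · have hv_test := hreal (v, z.2) ⟨⟨hv, hvD⟩, hzΛ⟩
      simp only [jointBound, sub_self, map_zero, clarkeDeriv_zero, mul_zero, add_zero,
        sub_zero] at hv_test
      rw [← coe_toReal_of_mem_effectiveDomain (hφ _) hvD, ge_iff_le]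
      norm_cast
      linarith
    · rw [not_lt_top_iff.1 (show ¬φ v < ⊤ from hvD), EReal.top_sub_coe, EReal.coe_add_top,
        EReal.top_add_coe]
      exact le_top
  · have hμ_test := hreal (z.1, μ) ⟨⟨hzK, hzD⟩, hμ⟩
    simp only [jointBound, sub_self, map_zero, clarkeDeriv_zero, add_zero, sub_zero] at hμ_test
    rw [ge_iff_le]
    linarith

end System

end CoupledSystem

open CoupledSystem in
theorem mainTheorem1_general {X Y Z₁ Z₂ : Type*}
    [NormedAddCommGroup X] [NormedSpace ℝ X] [NormedAddCommGroup Y] [NormedSpace ℝ Y]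
    [NormedAddCommGroup Z₁] [NormedSpace ℝ Z₁] [NormedAddCommGroup Z₂] [NormedSpace ℝ Z₂]
    {K : Set X} {Λ : Set Y} {B : X × Y → ℝ} {φ : X → EReal} {J : Z₁ → ℝ} {L : Z₂ → ℝ} {H : Y → ℝ}
    {γ₁ : X →ₗ[ℝ] Z₁} {γ₂ : Y →ₗ[ℝ] Z₂} {F : X → StrongDual ℝ X} {G : Y → StrongDual ℝ Y}
    (hK : IsCompact (toWeakSpace ℝ X '' K)) (hK_conv : Convex ℝ K)
    (hΛ_ne : Λ.Nonempty) (hΛ : IsCompact (toWeakSpace ℝ Y '' Λ)) (hΛ_conv : Convex ℝ Λ)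
    (hφ : ∀ x, φ x ≠ ⊥) (hφ_conv : IsConvexFunctional φ) (hφ_lsc : LowerSemicontinuous φ)
    (hφK : (effectiveDomain φ ∩ K).Nonempty)
    (hJ : LocallyLipschitz J) (hL : LocallyLipschitz L)
    (hγ₁ : IsCompactOperator γ₁) (hγ₂ : IsCompactOperator γ₂)
    (hH : ∀ σ, 0 ≤ H σ) (hH_cont : IsWeaklyContinuous H)
    (hB_conv : ConvexOn ℝ Set.univ B) (hB_lsc : LowerSemicontinuous B)
    (hF : IsWeaklyLscPairing F) (hG : IsWeaklyLscPairing G) :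
    ∃ (u : X) (σ : Y), IsSolution K Λ B φ J L H γ₁ γ₂ F G u σ := by
  have hQ := isCompact_toWeakSpace_image_prod hK hΛ
  have hQ_conv : Convex ℝ (K ×ˢ Λ) := hK_conv.prod hΛ_conv
  let D : Set (X × Y) := (K ∩ effectiveDomain φ) ×ˢ Λ
  have hDQ : D ⊆ K ×ˢ Λ := Set.prod_mono_left Set.inter_subset_left
  obtain ⟨v₀, hv₀D, hv₀K⟩ := hφK
  obtain ⟨μ₀, hμ₀⟩ := hΛ_ne
  let w₀ : D := ⟨(v₀, μ₀), ⟨hv₀K, hv₀D⟩, hμ₀⟩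
  have : Nonempty D := ⟨w₀⟩
  let S (w : D) : Set (X × Y) :=
    {z ∈ K ×ˢ Λ | φ z.1 ≤ (jointBound B φ J L H γ₁ γ₂ F G z w : ℝ)}
  have hS_seq : ∀ (w : D) (u : ℕ → X × Y) (z : X × Y), (∀ n, u n ∈ S w) → WeaklyConverges u z →
      z ∈ S w := fun w u z hu huz =>
    ⟨huz.mem_of_isCompact hQ fun n => (hu n).1, le_jointBound_of_weaklyConverges hφ_conv hφ_lsc
      hJ hL hγ₁ hγ₂ hH hH_cont hB_conv hB_lsc hF hG w huz fun n => (hu n).2⟩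
  have hS_cover : ∀ t : Finset D, convexHull ℝ (Subtype.val '' (t : Set D)) ⊆ ⋃ w ∈ t, S w := by
    intro t z hz
    have ht : Subtype.val '' (t : Set D) ⊆ D := Subtype.coe_image_subset D _
    obtain ⟨_, ⟨w, hw, rfl⟩, hle⟩ := exists_le_jointBound_of_mem_convexHull (H := H) hφ hφ_conv
      hJ hL hB_conv (fun w hw => (ht hw).1.2) hz (hH _)
    exact Set.mem_biUnion hw ⟨convexHull_min (ht.trans hDQ) hQ_conv hz, hle⟩
  obtain ⟨z, hz⟩ :=
    exists_mem_forall_of_weaklyConverges_mem hQ (fun w _ hz => hz.1) hS_seq hS_cover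
  exact ⟨z.1, z.2, isSolution_of_le_jointBound hφ (hz w₀).1.1
    ((hz w₀).2.trans_lt (EReal.coe_lt_top _)) (hz w₀).1.2 fun w hw => (hz ⟨w, hw⟩).2⟩

theorem mainTheorem1 {X Y Z₁ Z₂ : Type*}
    [NormedAddCommGroup X] [NormedSpace ℝ X] [CompleteSpace X]
    [NormedAddCommGroup Y] [NormedSpace ℝ Y] [CompleteSpace Y]
    [NormedAddCommGroup Z₁] [NormedSpace ℝ Z₁] [CompleteSpace Z₁]
    [NormedAddCommGroup Z₂] [NormedSpace ℝ Z₂] [CompleteSpace Z₂]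
    (hX : CoupledSystem.IsReflexive X) (hY : CoupledSystem.IsReflexive Y)
    (K : Set X) (hK_ne : K.Nonempty) (hK_bdd : Bornology.IsBounded K)
    (hK_closed : IsClosed K) (hK_conv : Convex ℝ K)
    (Λ : Set Y) (hΛ_ne : Λ.Nonempty) (hΛ_bdd : Bornology.IsBounded Λ)
    (hΛ_closed : IsClosed Λ) (hΛ_conv : Convex ℝ Λ)
    (φ : X → EReal) (hφ_proper : CoupledSystem.IsProper φ)
    (hφ_conv : CoupledSystem.IsConvexFunctional φ) (hφ_lsc : LowerSemicontinuous φ)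
    (hφK : (CoupledSystem.effectiveDomain φ ∩ K).Nonempty)
    (J : Z₁ → ℝ) (hJ : LocallyLipschitz J)
    (L : Z₂ → ℝ) (hL : LocallyLipschitz L)
    (γ₁ : X →ₗ[ℝ] Z₁) (hγ₁ : IsCompactOperator γ₁)
    (γ₂ : Y →ₗ[ℝ] Z₂) (hγ₂ : IsCompactOperator γ₂)
    (H : Y → ℝ) (mH : ℝ) (hH_range : ∀ σ, H σ ∈ Set.Ioo 0 mH)
    (hH_cont : CoupledSystem.IsWeaklyContinuous H)
    (B : X × Y → ℝ) (hB_conv : ConvexOn ℝ Set.univ B) (hB_lsc : LowerSemicontinuous B)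
    (F : X → StrongDual ℝ X) (hF : CoupledSystem.IsWeaklyLscPairing F)
    (G : Y → StrongDual ℝ Y) (hG : CoupledSystem.IsWeaklyLscPairing G) :
    ∃ (u : X) (σ : Y), CoupledSystem.IsSolution K Λ B φ J L H γ₁ γ₂ F G u σ := by
  exact mainTheorem1_general
    (hX.isCompact_toWeakSpace_image hK_bdd hK_closed hK_conv) hK_conv hΛ_ne
    (hY.isCompact_toWeakSpace_image hΛ_bdd hΛ_closed hΛ_conv) hΛ_conv hφ_proper.1 hφ_conv hφ_lsc
    hφK hJ hL hγ₁ hγ₂ (fun σ => (hH_range σ).1.le) hH_cont hB_conv hB_lsc hF hG
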